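/- Let $n\ge 1$, let $\alpha,s\ge 0$ be real, and let $0<p,q\le\infty$. For a Schwartz function $\Gamma_0$ on $\mathbb R^n\times\mathbb R^n$ put $$\Gamma(t,x,y)=\bigl(e^{\frac{it(\Delta_x-\Delta_y)}{2}}\Gamma_0\bigr)(x,y),\qquad t\in\mathbb R,\ x,y\in\mathbb R^n .$$ Assume that there is a finite constant $C$ such that, for all such $\Gamma_0$, $$\bigl\|\,|\nabla|_x^{\alpha}\,\Gamma(t,x,x)\bigr\|_{L^p(dt)L^q(dx)}\le C\,\|\Gamma_0(x,y)\|_{H^s(dx\,dy)},$$ where $|\nabla|_x^\alpha=(-\Delta_x)^{\alpha/2}$ acts on the function $x\mapsto\Gamma(t,x,x)$, and the norm on the left is $\bigl\|\,\|\cdot\|_{L^q(\mathbb R^n,dx)}\bigr\|_{L^p(\mathbb R,dt)}$. Then $p\ge 2$ and $q\ge 2$. -/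

import Mathlib

open MeasureTheory
open scoped FourierTransform ENNReal NNReal

noncomputable section

namespace Collapsing

/-- The physical space `ℝⁿ` with its Euclidean norm and Lebesgue measure. -/
abbrev Space (n : ℕ) : Type := EuclideanSpace ℝ (Fin n)

/-- The space `ℝⁿ × ℝⁿ` of pairs `(x, y)`, with the Euclidean norm
`‖(x, y)‖² = ‖x‖² + ‖y‖²` and Lebesgue measure. -/
abbrev Space₂ (n : ℕ) : Type := WithLp 2 (Space n × Space n)

/-- The Fourier symbol of `Δ_x - Δ_y` on `ℝⁿ × ℝⁿ`. The Fourier transform of Mathlib is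
`𝓕 f ζ = ∫ exp (-2πi ⟨z, ζ⟩) f z dz`, so `Δ_x` has the symbol `-(2π‖ξ‖)²`. -/
def symbol {n : ℕ} (ζ : Space₂ n) : ℝ :=
  -(2 * Real.pi * ‖ζ.fst‖) ^ 2 + (2 * Real.pi * ‖ζ.snd‖) ^ 2

/-- `Γ(t, x, y) = (exp (i t (Δ_x - Δ_y) / 2) Γ₀)(x, y)`: the Fourier multiplier with symbol
`exp (i t m(ζ) / 2)` applied to `Γ₀`, where `m` is the symbol of `Δ_x - Δ_y`. -/
def evolution {n : ℕ} (Γ₀ : SchwartzMap (Space₂ n) ℂ) (t : ℝ) (x y : Space n) : ℂ :=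
  𝓕⁻ (fun ζ : Space₂ n =>
      Complex.exp (Complex.I * (t : ℂ) * (symbol ζ : ℂ) / 2) * 𝓕 (fun z => Γ₀ z) ζ)
    (WithLp.toLp 2 (x, y))

/-- The fractional derivative `|∇|^α f`: the Fourier multiplier with symbol `(2π‖ξ‖)^α`. -/
def absGradPow {n : ℕ} (α : ℝ) (f : Space n → ℂ) : Space n → ℂ :=
  𝓕⁻ (fun ξ : Space n => (((2 * Real.pi * ‖ξ‖) ^ α : ℝ) : ℂ) * 𝓕 f ξ)

/-- The mixed norm `‖u‖_{L^p(dt) L^q(dx)}` over `t ∈ ℝ`, `x ∈ ℝⁿ`, with values in `[0, ∞]`. -/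
def mixedNorm {n : ℕ} (p q : ℝ≥0∞) (u : ℝ → Space n → ℂ) : ℝ≥0∞ :=
  eLpNorm (fun t : ℝ => eLpNorm (u t) q volume) p volume

/-- The Sobolev norm `‖f‖_{H^s} = ‖(1 + |2πζ|²)^{s/2} 𝓕 f(ζ)‖_{L²(dζ)}` on `ℝⁿ × ℝⁿ`. -/
def sobolevNorm {n : ℕ} (s : ℝ) (f : SchwartzMap (Space₂ n) ℂ) : ℝ≥0∞ :=
  eLpNorm (fun ζ : Space₂ n =>
    (((1 + (2 * Real.pi * ‖ζ‖) ^ 2) ^ (s / 2) : ℝ) : ℂ) * 𝓕 (fun z => f z) ζ) 2 volume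

/-- The collapsing estimate `‖|∇|_x^α Γ(t, x, x)‖_{L^p(dt) L^q(dx)} ≤ C ‖Γ₀‖_{H^s(dx dy)}`, as an
a priori estimate for Schwartz data, with a finite constant `C` independent of the data. -/
def CollapsingEstimate (n : ℕ) (α s : ℝ) (p q : ℝ≥0∞) : Prop :=
  ∃ C : ℝ≥0, ∀ Γ₀ : SchwartzMap (Space₂ n) ℂ,
    mixedNorm p q (fun t => absGradPow α (fun x => evolution Γ₀ t x x)) ≤
      (C : ℝ≥0∞) * sobolevNorm s Γ₀

end Collapsing

end

namespace Collapsing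

open Real Function
open scoped RealInnerProductSpace ContDiff

variable {n : ℕ}

/-! The estimate is tested on data whose Fourier transform `φ` is a bump with values in `[0, 1]`,
supported near `(e₀, 0)`, `|e₀| = 1`. There the Sobolev weight is bounded and `|∇|^α` costs nothing,
so with `J = ∫ φ²` the right side is `O(√J)`. The collapsed solution is an oscillatory integral of
`φ`; wherever its phase varies by at most 1 about some `θ₀(t, x)` on the support, its modulus is at
least `J / 2`. If this holds for `|t| < T`, `|x| < r`, then `√J · r^{n/q} · T^{1/p}` is bounded
(`CollapsingEstimate.le_of_phase`).

Restricting `φ` to a slab of width about `1 / R` around a level set of the symbol allows `T ~ R`,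
with `J ≳ R⁻¹`; localizing `ξ₁ + ξ₂` to a ball of radius about `1 / R` allows `r ~ R`, with `J ≳
R⁻ⁿ`. Letting `R → ∞` forces `1/p ≤ 1/2` and `1/q ≤ 1/2`. Both lower bounds on `J` come from one
pigeonhole argument (`exists_localized_bump`), which needs no geometry of the level sets. -/

/-! ### Restriction to the diagonal on the Fourier side -/

/-- The function `ξ ↦ ∫ g(ξ - η, η) dη`, the density of the image of `g dζ` under
`(ξ₁, ξ₂) ↦ ξ₁ + ξ₂`. -/
noncomputable def sumMarginal (g : Space₂ n → ℂ) (ξ : Space n) : ℂ :=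
  ∫ η, g (WithLp.toLp 2 (ξ - η, η))

/-- The shear `(ξ, η) ↦ (ξ - η, η)` as a homeomorphism onto `Space₂ n`. -/
noncomputable def shearHomeomorph (n : ℕ) : Space n × Space n ≃ₜ Space₂ n where
  toFun z := WithLp.toLp 2 (z.1 - z.2, z.2)
  invFun ζ := (ζ.fst + ζ.snd, ζ.snd)
  left_inv z := by simp
  right_inv ζ := by
    apply WithLp.ofLp_injective
    ext1 <;> simp
  continuous_toFun := by fun_prop
  continuous_invFun := by fun_prop

lemma continuous_shear {g : Space₂ n → ℂ} (hg : Continuous g) :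
    Continuous (fun z : Space n × Space n => g (WithLp.toLp 2 (z.1 - z.2, z.2))) :=
  hg.comp (shearHomeomorph n).continuous

lemma integrable_shear {g : Space₂ n → ℂ} (hg : Continuous g) (hgc : HasCompactSupport g) :
    Integrable (fun z : Space n × Space n => g (WithLp.toLp 2 (z.1 - z.2, z.2)))
      (volume.prod volume) :=
  (continuous_shear hg).integrable_of_hasCompactSupport
    (hgc.comp_homeomorph (shearHomeomorph n))

lemma integrable_sumMarginal {g : Space₂ n → ℂ} (hg : Continuous g)
    (hgc : HasCompactSupport g) : Integrable (sumMarginal g) :=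
  (integrable_shear hg hgc).integral_prod_left

lemma continuous_sumMarginal {g : Space₂ n → ℂ} (hg : Continuous g)
    (hgc : HasCompactSupport g) : Continuous (sumMarginal g) := by
  -- For every `ξ`, only `η` in this fixed compact set contribute.
  have hK : IsCompact ((fun ζ : Space₂ n => ζ.snd) '' tsupport g) :=
    hgc.isCompact.image (by fun_prop)
  have h := continuous_parametric_integral_of_continuous (μ := (volume : Measure (Space n)))
    (f := fun ξ η : Space n => g (WithLp.toLp 2 (ξ - η, η))) (continuous_shear hg) hK
  convert h using 2 with ξ
  refine (setIntegral_eq_integral_of_forall_compl_eq_zero fun η hη => ?_).symm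
  by_contra h0
  exact hη ⟨_, subset_tsupport g h0, rfl⟩

lemma integral_eq_integral_sumMarginal {g : Space₂ n → ℂ} (hg : Continuous g)
    (hgc : HasCompactSupport g) : ∫ ζ, g ζ = ∫ ξ, sumMarginal g ξ := by
  have hpres := WithLp.volume_preserving_toLp (Space n) (Space n)
  have hemb : MeasurableEmbedding (@WithLp.toLp 2 (Space n × Space n)) :=
    (MeasurableEquiv.toLp 2 (Space n × Space n)).measurableEmbedding
  have hint : Integrable (fun z : Space n × Space n => g (WithLp.toLp 2 z))
      (volume.prod volume) :=
    (hpres.integrable_comp_emb hemb).2 (hg.integrable_of_hasCompactSupport hgc)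
  calc ∫ ζ, g ζ = ∫ z : Space n × Space n, g (WithLp.toLp 2 z) :=
        (hpres.integral_comp hemb g).symm
    _ = ∫ η, ∫ ξ, g (WithLp.toLp 2 (ξ, η)) := integral_prod_symm _ hint
    _ = ∫ η, ∫ ξ, g (WithLp.toLp 2 (ξ - η, η)) := by
        congr with η
        exact (integral_sub_right_eq_self (fun ξ => g (WithLp.toLp 2 (ξ, η))) η).symm
    _ = ∫ ξ, sumMarginal g ξ :=
        (integral_integral_swap (f := fun ξ η => g (WithLp.toLp 2 (ξ - η, η)))
          (integrable_shear hg hgc)).symm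

lemma integral_mul_eq_integral_mul_sumMarginal {g : Space₂ n → ℂ} (hg : Continuous g)
    (hgc : HasCompactSupport g) {k : Space n → ℂ} (hk : Continuous k) :
    ∫ ζ, k (ζ.fst + ζ.snd) * g ζ = ∫ ξ, k ξ * sumMarginal g ξ := by
  rw [integral_eq_integral_sumMarginal
    (g := fun ζ : Space₂ n => k (ζ.fst + ζ.snd) * g ζ) (by fun_prop) hgc.mul_left]
  congr with ξ
  simp [sumMarginal, integral_const_mul]

lemma inner_toLp_diag (ζ : Space₂ n) (x : Space n) :
    ⟪ζ, WithLp.toLp 2 (x, x)⟫ = ⟪ζ.fst + ζ.snd, x⟫ := by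
  rw [WithLp.prod_inner_apply, inner_add_left]
  rfl

/-- On the diagonal the character depends on `ζ` only through `ξ₁ + ξ₂`, so the other variable
integrates out. -/
lemma fourierInv_diag {g : Space₂ n → ℂ} (hg : Continuous g)
    (hgc : HasCompactSupport g) (x : Space n) :
    𝓕⁻ g (WithLp.toLp 2 (x, x)) = 𝓕⁻ (sumMarginal g) x := by
  simp only [fourierInv_eq', inner_toLp_diag, smul_eq_mul]
  exact integral_mul_eq_integral_mul_sumMarginal hg hgc
    (k := fun ξ => Complex.exp (↑(2 * π * ⟪ξ, x⟫) * Complex.I)) (by fun_prop)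

lemma contDiff_symbol : ContDiff ℝ ∞ (symbol (n := n)) := by
  have h1 : ContDiff ℝ ∞ (fun ζ : Space₂ n => ζ.fst) :=
    (WithLp.fstL 2 ℝ (Space n) (Space n)).contDiff
  have h2 : ContDiff ℝ ∞ (fun ζ : Space₂ n => ζ.snd) :=
    (WithLp.sndL 2 ℝ (Space n) (Space n)).contDiff
  change ContDiff ℝ ∞ (fun ζ : Space₂ n => -(2 * π * ‖ζ.fst‖) ^ 2 + (2 * π * ‖ζ.snd‖) ^ 2)
  simp only [mul_pow]
  exact (contDiff_const.mul (h1.norm_sq ℝ)).neg.add (contDiff_const.mul (h2.norm_sq ℝ))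

/-- The Fourier transform of the diagonal of `𝓕⁻ g` is the marginal of `g`. -/
lemma fourier_fourierInv_diag {g : Space₂ n → ℂ} (hg : ContDiff ℝ ∞ g)
    (hgc : HasCompactSupport g) :
    𝓕 (fun x : Space n => 𝓕⁻ g (WithLp.toLp 2 (x, x))) = sumMarginal g := by
  let D : Space n →L[ℝ] Space₂ n :=
    (WithLp.prodContinuousLinearEquiv 2 ℝ (Space n) (Space n)).symm.toContinuousLinearMap ∘L
      (ContinuousLinearMap.id ℝ _).prod (ContinuousLinearMap.id ℝ _)
  have hD : AntilipschitzWith 1 D := by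
    refine AddMonoidHomClass.antilipschitz_of_bound D fun x => ?_
    have h : ‖x‖ ≤ ‖WithLp.toLp 2 (x, x)‖ := by
      rw [WithLp.prod_norm_eq_of_L2]
      exact Real.le_sqrt_of_sq_le (by simp)
    simpa [D] using h
  -- The diagonal restriction of a Schwartz function is Schwartz; this yields the integrability that
  -- Fourier inversion for the marginal requires.
  let G : SchwartzMap (Space n) ℂ :=
    SchwartzMap.compCLMOfAntilipschitz ℂ D.hasTemperateGrowth hD (𝓕⁻ (hgc.toSchwartzMap hg))
  have hG : (G : Space n → ℂ) = 𝓕⁻ (sumMarginal g) := by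
    ext x
    rw [← fourierInv_diag hg.continuous hgc]
    simp only [G, SchwartzMap.compCLMOfAntilipschitz_apply, SchwartzMap.fourierInv_coe]
    rfl
  have hint : Integrable (𝓕 (sumMarginal g)) := by
    have h := G.integrable (μ := volume)
    rw [hG] at h
    simpa [fourierInv_eq_fourier_neg] using h.comp_neg
  simp only [fourierInv_diag hg.continuous hgc]
  exact (continuous_sumMarginal hg.continuous hgc).fourier_fourierInv_eq
    (integrable_sumMarginal hg.continuous hgc) hint

/-! ### The collapsed solution as an oscillatory integral -/

/-- The phase of the oscillatory integral representing `Γ(t, x, x)`. -/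
noncomputable def phase (t : ℝ) (x : Space n) (ζ : Space₂ n) : ℝ :=
  2 * π * ⟪ζ.fst + ζ.snd, x⟫ + t * symbol ζ / 2

lemma continuous_symbol : Continuous (symbol (n := n)) := contDiff_symbol.continuous

lemma continuous_phase (t : ℝ) (x : Space n) : Continuous (phase t x) := by
  have := continuous_symbol (n := n)
  unfold phase
  fun_prop

/-- The symbol of `|∇|^α` at the frequency `ξ₁ + ξ₂`. -/
noncomputable def sumWeight (α : ℝ) (ζ : Space₂ n) : ℝ :=
  (2 * π * ‖ζ.fst + ζ.snd‖) ^ α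

lemma continuous_sumWeight {α : ℝ} (hα : 0 ≤ α) : Continuous (sumWeight (n := n) α) := by
  unfold sumWeight
  exact Continuous.rpow_const (by fun_prop) fun _ => Or.inr hα

/-- The collapsed, differentiated solution as an oscillatory integral over the data. -/
theorem absGradPow_evolution_diag {α : ℝ} (hα : 0 ≤ α) (Γ₀ : SchwartzMap (Space₂ n) ℂ)
    {φ : Space₂ n → ℂ} (hφ : ContDiff ℝ ∞ φ) (hφc : HasCompactSupport φ)
    (hΓ : 𝓕 (fun z => Γ₀ z) = φ) (t : ℝ) (x : Space n) :
    absGradPow α (fun y => evolution Γ₀ t y y) x =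
      ∫ ζ, Complex.exp (phase t x ζ * Complex.I) * (sumWeight α ζ * φ ζ) := by
  set g : Space₂ n → ℂ :=
    fun ζ => Complex.exp (Complex.I * (t : ℂ) * (symbol ζ : ℂ) / 2) * φ ζ with hgdef
  have hg : ContDiff ℝ ∞ g := by
    have h : ContDiff ℝ ∞ (fun ζ : Space₂ n => (symbol ζ : ℂ)) :=
      Complex.ofRealCLM.contDiff.comp contDiff_symbol
    exact (((contDiff_const.mul h).div_const 2).cexp).mul hφ
  have hgc : HasCompactSupport g := hφc.mul_left
  have hev : (fun y => evolution Γ₀ t y y) = fun y => 𝓕⁻ g (WithLp.toLp 2 (y, y)) := by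
    ext y
    simp only [evolution, hΓ, hgdef]
  have hw : Continuous (fun ξ : Space n => (((2 * π * ‖ξ‖) ^ α : ℝ) : ℂ)) :=
    Complex.continuous_ofReal.comp
      (Continuous.rpow_const (by fun_prop) fun _ => Or.inr hα)
  rw [absGradPow, hev, fourier_fourierInv_diag hg hgc, fourierInv_eq']
  simp only [smul_eq_mul, ← mul_assoc]
  rw [← integral_mul_eq_integral_mul_sumMarginal hg.continuous hgc
    (k := fun ξ => Complex.exp (↑(2 * π * ⟪ξ, x⟫) * Complex.I) * (((2 * π * ‖ξ‖) ^ α : ℝ) : ℂ))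
    (by fun_prop)]
  congr with ζ
  simp only [hgdef, phase, sumWeight]
  push_cast
  rw [add_mul, Complex.exp_add]
  ring_nf

/-- An oscillatory integral whose phase varies by at most `1` does not cancel. -/
lemma half_integral_le_norm_integral_exp_mul {X : Type*} [MeasurableSpace X] {μ : Measure X}
    {a θ : X → ℝ} (ha : Integrable a μ) (ha0 : ∀ x, 0 ≤ a x) (hθ : Measurable θ) {θ₀ : ℝ}
    (hθ₀ : ∀ x, a x ≠ 0 → |θ x - θ₀| ≤ 1) :
    (1 / 2) * ∫ x, a x ∂μ ≤ ‖∫ x, Complex.exp (θ x * Complex.I) * a x ∂μ‖ := by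
  have hint : Integrable (fun x => Complex.exp ((θ x - θ₀ : ℝ) * Complex.I) * (a x : ℂ)) μ := by
    refine ha.ofReal.bdd_mul (c := 1) ?_ (Filter.Eventually.of_forall fun x => ?_)
    · exact Measurable.aestronglyMeasurable (by fun_prop)
    · rw [Complex.norm_exp_ofReal_mul_I]
  -- Factor out the unimodular constant `exp (i θ₀)`; the real part then suffices, since `cos u ≥ 1
  -- - u² / 2 ≥ 1 / 2` for `|u| ≤ 1`.
  have hrot : ‖∫ x, Complex.exp (θ x * Complex.I) * a x ∂μ‖ =
      ‖∫ x, Complex.exp ((θ x - θ₀ : ℝ) * Complex.I) * a x ∂μ‖ := by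
    have h : ∀ x, Complex.exp (θ x * Complex.I) * (a x : ℂ) = Complex.exp (θ₀ * Complex.I) *
        (Complex.exp ((θ x - θ₀ : ℝ) * Complex.I) * a x) := fun x => by
      rw [← mul_assoc, ← Complex.exp_add]
      push_cast
      ring_nf
    simp_rw [h]
    rw [integral_const_mul, norm_mul, Complex.norm_exp_ofReal_mul_I, one_mul]
  rw [hrot]
  refine le_trans ?_ (Complex.re_le_norm _)
  have hre : (∫ x, Complex.exp ((θ x - θ₀ : ℝ) * Complex.I) * a x ∂μ).re =
      ∫ x, (Complex.exp ((θ x - θ₀ : ℝ) * Complex.I) * a x).re ∂μ :=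
    (integral_re hint).symm
  rw [hre, ← integral_const_mul]
  refine integral_mono (ha.const_mul _) hint.re fun x => ?_
  simp only [Complex.re_mul_ofReal, Complex.exp_ofReal_mul_I_re]
  by_cases h0 : a x = 0
  · simp [h0]
  refine mul_le_mul_of_nonneg_right ?_ (ha0 x)
  have h1 := Real.one_sub_sq_div_two_le_cos (x := θ x - θ₀)
  have h2 : (θ x - θ₀) ^ 2 ≤ 1 := (sq_le_one_iff_abs_le_one _).2 (hθ₀ x h0)
  linarith

/-- A Chebyshev-type lower bound for the `L^p` norm, for all `0 < p ≤ ∞`. -/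
lemma mul_measure_rpow_le_eLpNorm {X ε : Type*} [MeasurableSpace X] {μ : Measure X} [ENorm ε]
    {f : X → ε} {S : Set X} {K p : ℝ≥0∞} (hS : MeasurableSet S) (hμS : μ S ≠ 0) (hp : p ≠ 0)
    (hf : ∀ x ∈ S, K ≤ ‖f x‖ₑ) : K * μ S ^ (1 / p.toReal) ≤ eLpNorm f p μ := by
  -- For `p = ∞`, `1 / p.toReal = 0` and the measure factor is 1, which is correct because `μ S ≠
  -- 0`.
  have h := eLpNorm_indicator_const' (c := K) hS hμS hp
  rw [enorm_eq_self] at h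
  rw [← h]
  refine eLpNorm_mono_enorm fun x => ?_
  by_cases hx : x ∈ S
  · simpa [hx] using hf x hx
  · simp [hx]

/-! ### Pigeonhole and localized bumps -/

/-- Pigeonhole principle: a bounded map into a `d`-dimensional space sends a set of measure
at least `c r ^ d` into some ball of radius `r`. -/
lemma exists_le_measure_preimage_ball {X E : Type*} [MeasurableSpace X] {μ : Measure X}
    [IsFiniteMeasure μ] (hμ : μ ≠ 0) [NormedAddCommGroup E] [NormedSpace ℝ E]
    [FiniteDimensional ℝ E] [MeasurableSpace E] [BorelSpace E] {Φ : X → E} (hΦ : Measurable Φ)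
    {M : ℝ} (hM : ∀ᵐ x ∂μ, ‖Φ x‖ ≤ M) :
    ∃ c : ℝ, 0 < c ∧ ∀ r : ℝ, 0 < r → r ≤ 1 → ∃ e : E,
      ENNReal.ofReal (c * r ^ Module.finrank ℝ E) ≤ μ (Φ ⁻¹' Metric.ball e r) := by
  set ν : Measure E := Measure.addHaar
  set B : Set E := Metric.ball 0 (M + 1)
  have hM0 : 0 ≤ M := by
    have : NeZero μ := ⟨hμ⟩
    obtain ⟨x, hx⟩ := hM.exists
    exact (norm_nonneg _).trans hx
  have hB0 : ν B ≠ 0 := (Metric.measure_ball_pos ν 0 (by linarith)).ne'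
  have hBt : ν B ≠ ⊤ := measure_ball_lt_top.ne
  have hU0 : ν (Metric.ball 0 1) ≠ 0 := (Metric.measure_ball_pos ν 0 one_pos).ne'
  have hUt : ν (Metric.ball 0 1) ≠ ⊤ := measure_ball_lt_top.ne
  -- By Fubini, `C r ^ d` is the average over `e ∈ B` of the measure of the preimage of `ball e r`;
  -- the radius `M + 1` of `B` leaves room for `r ≤ 1`. Some `e` attains at least the average.
  set C : ℝ≥0∞ := μ Set.univ * ν (Metric.ball 0 1) / ν B with hC
  have hC0 : C ≠ 0 := by
    simp [C, ENNReal.div_eq_zero_iff, hμ, hU0, hBt]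
  have hCt : C ≠ ⊤ := ENNReal.div_ne_top (ENNReal.mul_ne_top (measure_ne_top _ _) hUt) hB0
  refine ⟨C.toReal, ENNReal.toReal_pos hC0 hCt, fun r hr hr1 => ?_⟩
  set T : Set (X × E) := {z | dist z.2 (Φ z.1) < r}
  have hT : MeasurableSet T :=
    measurableSet_lt (measurable_snd.dist (hΦ.comp measurable_fst)) measurable_const
  have h1 : (μ.prod (ν.restrict B)) T =
      μ Set.univ * (ENNReal.ofReal (r ^ Module.finrank ℝ E) * ν (Metric.ball 0 1)) := by
    rw [Measure.prod_apply hT, mul_comm, ← lintegral_const]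
    refine lintegral_congr_ae ?_
    filter_upwards [hM] with x hx
    have hpre : Prod.mk x ⁻¹' T = Metric.ball (Φ x) r := by
      ext e; simp [T]
    rw [hpre, Measure.restrict_apply measurableSet_ball, Set.inter_eq_left.2,
      Measure.addHaar_ball_of_pos ν _ hr]
    refine Metric.ball_subset_ball' ?_
    rw [dist_zero_right]
    linarith
  have h2 : ∫⁻ e in B, μ (Φ ⁻¹' Metric.ball e r) ∂ν = (μ.prod (ν.restrict B)) T := by
    rw [Measure.prod_apply_symm hT]
    congr with e
    congr 1
    ext x
    simp [T, dist_comm]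
  have hfin : ∫⁻ e in B, μ (Φ ⁻¹' Metric.ball e r) ∂ν ≠ ⊤ := by
    rw [h2, h1]
    exact ENNReal.mul_ne_top (measure_ne_top _ _) (ENNReal.mul_ne_top ENNReal.ofReal_ne_top hUt)
  obtain ⟨e, -, he⟩ := exists_setLAverage_le hB0 measurableSet_ball.nullMeasurableSet hfin
  refine ⟨e, le_trans (le_of_eq ?_) he⟩
  rw [setLAverage_eq, h2, h1, ENNReal.ofReal_mul ENNReal.toReal_nonneg, ENNReal.ofReal_toReal hCt,
    hC, ENNReal.div_eq_inv_mul, ENNReal.div_eq_inv_mul]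
  ring

/-- Localization of a bump function to a slab of thickness `1 / R`, with the lower bound for its
`L²` norm that the pigeonhole principle gives. -/
lemma exists_localized_bump {V E : Type*} [NormedAddCommGroup V] [InnerProductSpace ℝ V]
    [FiniteDimensional ℝ V] [MeasurableSpace V] [BorelSpace V] [NormedAddCommGroup E]
    [InnerProductSpace ℝ E] [FiniteDimensional ℝ E] [MeasurableSpace E] [BorelSpace E]
    (μ : Measure V) [μ.IsAddHaarMeasure] (z₀ : V) {Φ : V → E} (hΦ : ContDiff ℝ ∞ Φ) :
    ∃ c : ℝ, 0 < c ∧ ∀ R : ℝ, 1 ≤ R → ∃ (e : E) (φ : V → ℝ), ContDiff ℝ ∞ φ ∧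
      HasCompactSupport φ ∧ (∀ z, 0 ≤ φ z) ∧ (∀ z, φ z ≤ 1) ∧
      (∀ z, φ z ≠ 0 → dist z z₀ < 1 / 4 ∧ ‖Φ z - e‖ < 2 / R) ∧
      c * (1 / R) ^ Module.finrank ℝ E ≤ ∫ z, φ z ^ 2 ∂μ := by
  set A : Set V := Metric.ball z₀ (1 / 8)
  obtain ⟨M, hM⟩ := (isCompact_closedBall z₀ (1 / 8)).exists_bound_of_continuousOn
    hΦ.continuous.continuousOn
  have hμA : μ.restrict A ≠ 0 := by
    rw [Ne, Measure.restrict_eq_zero]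
    exact (Metric.measure_ball_pos μ z₀ (by norm_num)).ne'
  have : IsFiniteMeasure (μ.restrict A) := ⟨by simpa using measure_ball_lt_top⟩
  obtain ⟨c, hc, h⟩ := exists_le_measure_preimage_ball hμA hΦ.continuous.measurable (M := M) (by
    filter_upwards [ae_restrict_mem measurableSet_ball] with z hz
    exact hM z (Metric.ball_subset_closedBall hz))
  refine ⟨c, hc, fun R hR => ?_⟩
  have hR0 : 0 < R := by linarith
  obtain ⟨e, he⟩ := h (1 / R) (by positivity) (by rw [div_le_one hR0]; exact hR)
  let χ : ContDiffBump z₀ := ⟨1 / 8, 1 / 4, by norm_num, by norm_num⟩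
  let ψ : ContDiffBump e := ⟨1 / R, 2 / R, by positivity, by gcongr; norm_num⟩
  have hsm : ContDiff ℝ ∞ (fun z => χ z * ψ (Φ z)) := χ.contDiff.mul (ψ.contDiff.comp hΦ)
  have hcs : HasCompactSupport (fun z => χ z * ψ (Φ z)) := χ.hasCompactSupport.mul_right
  refine ⟨e, fun z => χ z * ψ (Φ z), hsm, hcs, fun z => mul_nonneg χ.nonneg ψ.nonneg,
    fun z => mul_le_one₀ χ.le_one ψ.nonneg ψ.le_one, fun z hz => ⟨?_, ?_⟩, ?_⟩
  · have : z ∈ support χ := left_ne_zero_of_mul hz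
    rwa [χ.support_eq] at this
  · have : Φ z ∈ support ψ := right_ne_zero_of_mul hz
    rw [ψ.support_eq] at this
    simpa [dist_eq_norm] using this
  set S : Set V := Φ ⁻¹' Metric.ball e (1 / R) ∩ A
  have hSm : MeasurableSet S :=
    (hΦ.continuous.measurable measurableSet_ball).inter measurableSet_ball
  have hSt : μ S ≠ ⊤ := (measure_mono Set.inter_subset_right |>.trans_lt measure_ball_lt_top).ne
  rw [Measure.restrict_apply (hΦ.continuous.measurable measurableSet_ball)] at he
  have hint : Integrable (fun z => (χ z * ψ (Φ z)) ^ 2) μ := by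
    refine (hsm.continuous.pow 2).integrable_of_hasCompactSupport ?_
    simp only [pow_two]
    exact hcs.mul_left
  calc c * (1 / R) ^ Module.finrank ℝ E ≤ μ.real S := by
        rw [Measure.real, ← ENNReal.ofReal_le_iff_le_toReal hSt]
        exact he
    _ = ∫ z, S.indicator (fun _ => (1 : ℝ)) z ∂μ := by
        rw [integral_indicator_const _ hSm, smul_eq_mul, mul_one]
    _ ≤ ∫ z, (χ z * ψ (Φ z)) ^ 2 ∂μ := by
        refine integral_mono ((integrable_indicator_iff hSm).2 (by simp [hSt.lt_top]))
          hint fun z => ?_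
        refine Set.indicator_apply_le' (fun hz => ?_) fun _ => sq_nonneg _
        rw [χ.one_of_mem_closedBall (Metric.ball_subset_closedBall hz.2),
          ψ.one_of_mem_closedBall (Metric.ball_subset_closedBall hz.1)]
        norm_num

/-- If `R ^ (d κ)` is dominated by `R ^ (d / 2)` for large `R`, then `κ ≤ 1 / 2`. -/
lemma le_half_of_forall_mul_rpow_le {d : ℕ} (hd : d ≠ 0) {a b c δ κ C : ℝ} (ha : 0 < a)
    (hb : 0 < b) (hc : 0 < c) (hδ : 0 < δ)
    (h : ∀ R : ℝ, 1 ≤ R → a * √(c * (1 / R) ^ d) * ((δ * R) ^ d * b) ^ κ ≤ C) : κ ≤ 1 / 2 := by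
  by_contra! hκ
  have hdpos : (0 : ℝ) < d := by positivity
  -- The net power of `R` on the left of `h`.
  set γ : ℝ := d * (κ - 1 / 2) with hγ
  have hγ0 : 0 < γ := mul_pos hdpos (by linarith)
  set k : ℝ := a * √c * (δ ^ d * b) ^ κ with hk
  have hk0 : 0 < k := by positivity
  have key : ∀ R : ℝ, 1 ≤ R → k * R ^ γ ≤ C := fun R hR => by
    have hR0 : 0 < R := by linarith
    refine le_trans (le_of_eq ?_) (h R hR)
    have e1 : √(c * (1 / R) ^ d) = √c * R ^ (-(d : ℝ) / 2) := by
      rw [Real.sqrt_mul hc.le, one_div, inv_pow, ← Real.rpow_natCast, ← Real.rpow_neg hR0.le,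
        Real.sqrt_eq_rpow (R ^ _), ← Real.rpow_mul hR0.le]
      ring_nf
    have e2 : ((δ * R) ^ d * b) ^ κ = (δ ^ d * b) ^ κ * R ^ (d * κ) := by
      rw [mul_pow, mul_right_comm, Real.mul_rpow (by positivity) (by positivity),
        ← Real.rpow_natCast R, ← Real.rpow_mul hR0.le]
    have e3 : R ^ γ = R ^ (-(d : ℝ) / 2) * R ^ (d * κ) := by
      rw [← Real.rpow_add hR0, hγ]
      ring_nf
    rw [e1, e2, e3, hk]
    ring
  obtain ⟨R, hR, hR1⟩ := (((tendsto_rpow_atTop hγ0).eventually_gt_atTop (C / k)).and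
    (Filter.eventually_ge_atTop 1)).exists
  have := key R hR1
  rw [div_lt_iff₀ hk0] at hR
  linarith

/-! ### Testing the estimate on frequency bumps -/

/-- The bounds on the support of the data: for `ζ` near `(e₀, 0)` with `e₀` a unit vector, the
frequency `ξ₁ + ξ₂` is bounded above and away from `0`. -/
lemma bounds_near_unit {e₀ : Space n} (he₀ : ‖e₀‖ = 1) {ζ : Space₂ n}
    (hζ : dist ζ (WithLp.toLp 2 (e₀, 0)) < 1 / 4) :
    1 / 2 ≤ ‖ζ.fst + ζ.snd‖ ∧ ‖ζ.fst + ζ.snd‖ ≤ 2 ∧ ‖ζ‖ ≤ 2 := by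
  rw [dist_eq_norm] at hζ
  have h1 : ‖ζ.fst - e₀‖ < 1 / 4 := by
    simpa using (WithLp.norm_fst_le _ (ζ - WithLp.toLp 2 (e₀, 0))).trans_lt hζ
  have h2 : ‖ζ.snd‖ < 1 / 4 := by
    simpa using (WithLp.norm_snd_le _ (ζ - WithLp.toLp 2 (e₀, 0))).trans_lt hζ
  have h0 : ‖(WithLp.toLp 2 (e₀, 0) : Space₂ n)‖ = 1 := by
    rw [WithLp.prod_norm_eq_of_L2]
    simp [he₀]
  refine ⟨?_, ?_, ?_⟩
  · have e : e₀ = (ζ.fst + ζ.snd) - (ζ.fst - e₀) - ζ.snd := by abel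
    have := norm_sub_le ((ζ.fst + ζ.snd) - (ζ.fst - e₀)) ζ.snd
    have := norm_sub_le (ζ.fst + ζ.snd) (ζ.fst - e₀)
    rw [← e, he₀] at *
    linarith
  · have e : ζ.fst + ζ.snd = e₀ + (ζ.fst - e₀) + ζ.snd := by abel
    rw [e]
    have := norm_add₃_le (a := e₀) (b := ζ.fst - e₀) (c := ζ.snd)
    linarith
  · have e : ζ = WithLp.toLp 2 (e₀, 0) + (ζ - WithLp.toLp 2 (e₀, 0)) := by abel
    rw [e]
    have := norm_add_le (WithLp.toLp 2 (e₀, 0)) (ζ - WithLp.toLp 2 (e₀, 0))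
    linarith

lemma abs_symbol_le {ζ : Space₂ n} (hζ : ‖ζ‖ ≤ 2) : |symbol ζ| ≤ 256 := by
  have h1 : ‖ζ.fst‖ ≤ 2 := (WithLp.norm_fst_le _ ζ).trans hζ
  have h2 : ‖ζ.snd‖ ≤ 2 := (WithLp.norm_snd_le _ ζ).trans hζ
  have hb : ∀ r : ℝ, 0 ≤ r → r ≤ 2 → 0 ≤ (2 * π * r) ^ 2 ∧ (2 * π * r) ^ 2 ≤ 256 := by
    intro r hr0 hr
    have hle : 2 * π * r ≤ 2 * 4 * 2 := by
      have := Real.pi_le_four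
      gcongr
    have h0 : 0 ≤ 2 * π * r := by positivity
    exact ⟨by positivity, by nlinarith⟩
  have := hb _ (norm_nonneg _) h1
  have := hb _ (norm_nonneg _) h2
  rw [symbol, abs_le]
  constructor <;> linarith

/-- The estimate tested on a nonnegative bump function in frequency: on any box on which the phase
is nearly constant over the support of the bump, the solution does not oscillate. -/
lemma CollapsingEstimate.le_of_phase {α s : ℝ} (hα : 0 ≤ α) (hs : 0 ≤ s) {p q : ℝ≥0∞}
    (hp : 0 < p) (hq : 0 < q) (h : CollapsingEstimate n α s p q) {e₀ : Space n}
    (he₀ : ‖e₀‖ = 1) :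
    ∃ C : ℝ, ∀ φ : Space₂ n → ℝ, ContDiff ℝ ∞ φ → HasCompactSupport φ → (∀ ζ, 0 ≤ φ ζ) →
      (∀ ζ, φ ζ ≤ 1) → (∀ ζ, φ ζ ≠ 0 → dist ζ (WithLp.toLp 2 (e₀, 0)) < 1 / 4) →
      0 < ∫ ζ, φ ζ ^ 2 → ∀ T r : ℝ, 0 < T → 0 < r → ∀ θ₀ : ℝ → Space n → ℝ,
      (∀ t ∈ Metric.ball (0 : ℝ) T, ∀ x ∈ Metric.ball (0 : Space n) r, ∀ ζ, φ ζ ≠ 0 →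
        |phase t x ζ - θ₀ t x| ≤ 1) →
      √(∫ ζ, φ ζ ^ 2) * volume.real (Metric.ball (0 : Space n) r) ^ (1 / q.toReal) *
        volume.real (Metric.ball (0 : ℝ) T) ^ (1 / p.toReal) ≤ C := by
  obtain ⟨C, hC⟩ := h
  set W : ℝ := (1 + (2 * π * 2) ^ 2) ^ (s / 2)
  have hW0 : 0 ≤ W := by positivity
  refine ⟨2 * C * W, fun φ hφ hφc hφ0 hφ1 hφs hJ T r hT hr θ₀ hθ => ?_⟩
  set J : ℝ := ∫ ζ, φ ζ ^ 2 with hJdef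
  set f : Space₂ n → ℂ := fun ζ => φ ζ with hf
  have hfs : ContDiff ℝ ∞ f := Complex.ofRealCLM.contDiff.comp hφ
  have hfc : HasCompactSupport f := hφc.comp_left (g := Complex.ofReal) rfl
  let Γ₀ : SchwartzMap (Space₂ n) ℂ := 𝓕⁻ (hfc.toSchwartzMap hfs)
  have hΓ : 𝓕 (fun z => Γ₀ z) = f := by
    have h1 : 𝓕 Γ₀ = hfc.toSchwartzMap hfs := FourierTransform.fourier_fourierInv_eq _
    have h2 := SchwartzMap.fourier_coe Γ₀
    rw [h1] at h2
    exact h2.symm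
  set u : ℝ → Space n → ℂ := fun t => absGradPow α (fun x => evolution Γ₀ t x x)
  have hlower : ∀ t ∈ Metric.ball (0 : ℝ) T, ∀ x ∈ Metric.ball (0 : Space n) r,
      ENNReal.ofReal (J / 2) ≤ ‖u t x‖ₑ := by
    intro t ht x hx
    set a : Space₂ n → ℝ := fun ζ => sumWeight α ζ * φ ζ with ha
    have hac : Continuous a := (continuous_sumWeight hα).mul hφ.continuous
    have hai : Integrable a := hac.integrable_of_hasCompactSupport hφc.mul_left
    have hw0 : ∀ ζ : Space₂ n, 0 ≤ sumWeight α ζ := fun ζ => by unfold sumWeight; positivity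
    have hosc := half_integral_le_norm_integral_exp_mul hai
      (fun ζ => mul_nonneg (hw0 ζ) (hφ0 ζ)) (continuous_phase t x).measurable
      (θ₀ := θ₀ t x) fun ζ hζ => hθ t ht x hx ζ (right_ne_zero_of_mul hζ)
    -- On the support `2π|ξ₁ + ξ₂| ≥ π > 1`, so the weight is at least 1, and `φ² ≤ φ`.
    have hJa : J ≤ ∫ ζ, a ζ := by
      refine integral_mono ?_ hai fun ζ => ?_
      · refine (hφ.continuous.pow 2).integrable_of_hasCompactSupport ?_
        simp only [pow_two]
        exact hφc.mul_left
      · by_cases h0 : φ ζ = 0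
        · simp [ha, h0]
        have hb := bounds_near_unit he₀ (hφs ζ h0)
        have hw1 : 1 ≤ sumWeight α ζ := by
          refine Real.one_le_rpow ?_ hα
          nlinarith [Real.pi_gt_three, hb.1]
        simp only [ha, pow_two]
        exact mul_le_mul_of_nonneg_right ((hφ1 ζ).trans hw1) (hφ0 ζ)
    have hrep := absGradPow_evolution_diag hα Γ₀ hfs hfc hΓ t x
    have hnorm : J / 2 ≤ ‖u t x‖ := by
      change J / 2 ≤ ‖absGradPow α (fun y => evolution Γ₀ t y y) x‖
      rw [hrep]
      simp only [ha, Complex.ofReal_mul] at hosc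
      linarith
    rw [← ofReal_norm]
    exact ENNReal.ofReal_le_ofReal hnorm
  have hmixed : ENNReal.ofReal (J / 2) * volume (Metric.ball (0 : Space n) r) ^ (1 / q.toReal) *
      volume (Metric.ball (0 : ℝ) T) ^ (1 / p.toReal) ≤ mixedNorm p q u := by
    refine mul_measure_rpow_le_eLpNorm measurableSet_ball
      (Metric.measure_ball_pos _ _ hT).ne' hp.ne' fun t ht => ?_
    rw [enorm_eq_self]
    exact mul_measure_rpow_le_eLpNorm measurableSet_ball
      (Metric.measure_ball_pos _ _ hr).ne' hq.ne' (hlower t ht)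
  have hsob : sobolevNorm s Γ₀ ≤ ENNReal.ofReal (W * √J) := by
    have h2 : eLpNorm f 2 volume = ENNReal.ofReal (√J) := by
      rw [(hfs.continuous.memLp_of_hasCompactSupport hfc).eLpNorm_eq_integral_rpow_norm
        two_ne_zero ENNReal.ofNat_ne_top, Real.sqrt_eq_rpow, hJdef]
      simp [hf, one_div]
    rw [ENNReal.ofReal_mul hW0, ← h2, sobolevNorm, hΓ]
    refine eLpNorm_le_mul_eLpNorm_of_ae_le_mul (Filter.Eventually.of_forall fun ζ => ?_) 2
    by_cases h0 : φ ζ = 0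
    · simp [hf, h0]
    rw [norm_mul, Complex.norm_real, Real.norm_of_nonneg (by positivity)]
    refine mul_le_mul_of_nonneg_right ?_ (norm_nonneg _)
    have hb := (bounds_near_unit he₀ (hφs ζ h0)).2.2
    exact Real.rpow_le_rpow (by positivity) (by gcongr) (by positivity)
  have hfinal := (hmixed.trans (hC Γ₀)).trans (mul_le_mul_right hsob _)
  have hreal := ENNReal.toReal_mono (by finiteness) hfinal
  rw [ENNReal.toReal_mul, ENNReal.toReal_mul, ENNReal.toReal_mul, ← ENNReal.toReal_rpow,
    ← ENNReal.toReal_rpow, ENNReal.toReal_ofReal (by positivity),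
    ENNReal.toReal_ofReal (by positivity), ENNReal.coe_toReal] at hreal
  -- The lower bound is linear in `J`, the upper one in `√J`: cancel one `√J`.
  have hJs : √J * √J = J := Real.mul_self_sqrt hJ.le
  have hsJ : 0 < √J := Real.sqrt_pos.2 hJ
  simp only [Measure.real]
  refine le_of_mul_le_mul_left ?_ hsJ
  set P := (volume (Metric.ball (0 : Space n) r)).toReal ^ (1 / q.toReal)
  set Q := (volume (Metric.ball (0 : ℝ) T)).toReal ^ (1 / p.toReal)
  calc √J * (√J * P * Q) = 2 * (J / 2 * P * Q) := by rw [← mul_assoc, ← mul_assoc, hJs]; ring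
    _ ≤ 2 * (C * (W * √J)) := by gcongr
    _ = √J * (2 * C * W) := by ring

lemma volume_real_ball_mul {E : Type*} [NormedAddCommGroup E] [InnerProductSpace ℝ E]
    [FiniteDimensional ℝ E] [MeasurableSpace E] [BorelSpace E] {r : ℝ} (hr : 0 < r) :
    volume.real (Metric.ball (0 : E) r) =
      r ^ Module.finrank ℝ E * volume.real (Metric.ball (0 : E) 1) := by
  rw [Measure.real, Measure.addHaar_ball_of_pos _ _ hr, ENNReal.toReal_mul,
    ENNReal.toReal_ofReal (by positivity), Measure.real]

lemma volume_real_ball_pos {E : Type*} [NormedAddCommGroup E] [InnerProductSpace ℝ E]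
    [FiniteDimensional ℝ E] [MeasurableSpace E] [BorelSpace E] {r : ℝ} (hr : 0 < r) :
    0 < volume.real (Metric.ball (0 : E) r) :=
  ENNReal.toReal_pos (Metric.measure_ball_pos _ _ hr).ne' measure_ball_lt_top.ne

lemma two_le_of_one_div_toReal_le_half {p : ℝ≥0∞} (hp : 0 < p) (h : 1 / p.toReal ≤ 1 / 2) :
    2 ≤ p := by
  rcases eq_or_ne p ⊤ with rfl | hpt
  · exact le_top
  have hp0 : 0 < p.toReal := ENNReal.toReal_pos hp.ne' hpt
  have h2 : 2 ≤ p.toReal := (one_div_le_one_div hp0 two_pos).1 h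
  simpa using (ENNReal.ofReal_le_iff_le_toReal hpt).2 h2

/-! ### The two necessary conditions -/

/-- Data with frequencies in a thin slab around a level set of the symbol of `Δ_x - Δ_y` persist
for a long time. -/
theorem CollapsingEstimate.two_le_time_exponent (hn : n ≠ 0) {α s : ℝ} (hα : 0 ≤ α) (hs : 0 ≤ s)
    {p q : ℝ≥0∞} (hp : 0 < p) (hq : 0 < q) (h : CollapsingEstimate n α s p q) : 2 ≤ p := by
  have : Nonempty (Fin n) := Fin.pos_iff_nonempty.1 (Nat.pos_of_ne_zero hn)
  obtain ⟨e₀, he₀⟩ := exists_norm_eq (Space n) zero_le_one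
  obtain ⟨C, hC⟩ := h.le_of_phase hα hs hp hq he₀
  obtain ⟨c, hc, hφ⟩ := exists_localized_bump (volume : Measure (Space₂ n))
    (WithLp.toLp 2 (e₀, 0)) contDiff_symbol
  refine two_le_of_one_div_toReal_le_half hp ?_
  -- The phase error below is at most `16δ + δ ≤ 1`.
  set δ : ℝ := 1 / 300
  have hδ0 : 0 < δ := by norm_num [δ]
  refine le_half_of_forall_mul_rpow_le (d := Module.finrank ℝ ℝ) (by simp)
    (a := volume.real (Metric.ball (0 : Space n) δ) ^ (1 / q.toReal))
    (b := volume.real (Metric.ball (0 : ℝ) 1)) (C := C)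
    (Real.rpow_pos_of_pos (volume_real_ball_pos hδ0) _) (volume_real_ball_pos one_pos) hc hδ0
    fun R hR => ?_
  have hR0 : 0 < R := by linarith
  obtain ⟨e, φ, hsm, hcs, h0, h1, hsupp, hJ⟩ := hφ R hR
  have hest := hC φ hsm hcs h0 h1 (fun ζ hζ => (hsupp ζ hζ).1)
    (lt_of_lt_of_le (by positivity) hJ) (δ * R) δ (by positivity) hδ0 (fun t _ => t * e / 2) ?_
  · rw [volume_real_ball_mul (E := ℝ) (by positivity)] at hest
    refine le_trans ?_ hest
    rw [mul_comm (_ ^ (1 / q.toReal))]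
    gcongr
  intro t ht x hx ζ hζ
  obtain ⟨hd, hsym⟩ := hsupp ζ hζ
  rw [mem_ball_zero_iff] at ht hx
  have hb := (bounds_near_unit he₀ hd).2.1
  have e1 : phase t x ζ - t * e / 2 = 2 * π * ⟪ζ.fst + ζ.snd, x⟫ + t * (symbol ζ - e) / 2 := by
    unfold phase; ring
  have b1 : |2 * π * ⟪ζ.fst + ζ.snd, x⟫| ≤ 2 * 4 * (2 * δ) := by
    rw [abs_mul, abs_of_pos Real.two_pi_pos]
    have := Real.pi_le_four
    have := abs_real_inner_le_norm (ζ.fst + ζ.snd) x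
    gcongr
    exact this.trans (by gcongr)
  have b2 : |t * (symbol ζ - e) / 2| ≤ δ := by
    rw [abs_div, abs_mul, abs_two]
    calc |t| * |symbol ζ - e| / 2 ≤ (δ * R) * (2 / R) / 2 := by
          gcongr
          · exact ht.le
          · exact hsym.le
      _ = δ := by field_simp
  rw [e1]
  refine (abs_add_le _ _).trans ((add_le_add b1 b2).trans ?_)
  norm_num [δ]

/-- Data with `ξ₁ + ξ₂` in a small ball are spread out in space. -/
theorem CollapsingEstimate.two_le_space_exponent (hn : n ≠ 0) {α s : ℝ} (hα : 0 ≤ α)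
    (hs : 0 ≤ s) {p q : ℝ≥0∞} (hp : 0 < p) (hq : 0 < q) (h : CollapsingEstimate n α s p q) :
    2 ≤ q := by
  have : Nonempty (Fin n) := Fin.pos_iff_nonempty.1 (Nat.pos_of_ne_zero hn)
  obtain ⟨e₀, he₀⟩ := exists_norm_eq (Space n) zero_le_one
  obtain ⟨C, hC⟩ := h.le_of_phase hα hs hp hq he₀
  have hadd : ContDiff ℝ ∞ (fun ζ : Space₂ n => ζ.fst + ζ.snd) :=
    (WithLp.fstL 2 ℝ (Space n) (Space n) + WithLp.sndL 2 ℝ (Space n) (Space n)).contDiff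
  obtain ⟨c, hc, hφ⟩ := exists_localized_bump (volume : Measure (Space₂ n))
    (WithLp.toLp 2 (e₀, 0)) hadd
  refine two_le_of_one_div_toReal_le_half hq ?_
  -- Here the phase error is at most `16δ + 128δ ≤ 1`, the second term from `|symbol| ≤ 256`.
  set δ : ℝ := 1 / 300
  have hδ0 : 0 < δ := by norm_num [δ]
  refine le_half_of_forall_mul_rpow_le (d := Module.finrank ℝ (Space n)) (by simpa using hn)
    (a := volume.real (Metric.ball (0 : ℝ) δ) ^ (1 / p.toReal))
    (b := volume.real (Metric.ball (0 : Space n) 1)) (C := C)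
    (Real.rpow_pos_of_pos (volume_real_ball_pos hδ0) _) (volume_real_ball_pos one_pos) hc hδ0
    fun R hR => ?_
  have hR0 : 0 < R := by linarith
  obtain ⟨e, φ, hsm, hcs, h0, h1, hsupp, hJ⟩ := hφ R hR
  have hest := hC φ hsm hcs h0 h1 (fun ζ hζ => (hsupp ζ hζ).1)
    (lt_of_lt_of_le (by positivity) hJ) δ (δ * R) hδ0 (by positivity)
    (fun _ x => 2 * π * ⟪e, x⟫) ?_
  · rw [volume_real_ball_mul (E := Space n) (r := δ * R) (by positivity)] at hest
    refine le_trans ?_ hest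
    rw [mul_assoc (_ ^ (1 / p.toReal)), mul_comm (_ ^ (1 / p.toReal))]
    gcongr
  intro t ht x hx ζ hζ
  obtain ⟨hd, hsum⟩ := hsupp ζ hζ
  rw [mem_ball_zero_iff] at ht hx
  have hb := abs_symbol_le (bounds_near_unit he₀ hd).2.2
  have e1 : phase t x ζ - 2 * π * ⟪e, x⟫ =
      2 * π * ⟪ζ.fst + ζ.snd - e, x⟫ + t * symbol ζ / 2 := by
    rw [phase, inner_sub_left]; ring
  have b1 : |2 * π * ⟪ζ.fst + ζ.snd - e, x⟫| ≤ 2 * 4 * (2 * δ) := by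
    rw [abs_mul, abs_of_pos Real.two_pi_pos]
    have := Real.pi_le_four
    have hin := abs_real_inner_le_norm (ζ.fst + ζ.snd - e) x
    gcongr
    calc _ ≤ ‖ζ.fst + ζ.snd - e‖ * ‖x‖ := hin
      _ ≤ 2 / R * (δ * R) := by gcongr
      _ = 2 * δ := by field_simp
  have b2 : |t * symbol ζ / 2| ≤ δ * 256 / 2 := by
    rw [abs_div, abs_mul, abs_two]
    gcongr
    exact ht.le
  rw [e1]
  refine (abs_add_le _ _).trans ((add_le_add b1 b2).trans ?_)
  norm_num [δ]

end Collapsing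

theorem theorem2 (n : ℕ) (hn : 1 ≤ n) (α s : ℝ) (hα : 0 ≤ α) (hs : 0 ≤ s)
    (p q : ENNReal) (hp : 0 < p) (hq : 0 < q)
    (h : Collapsing.CollapsingEstimate n α s p q) :
    2 ≤ p ∧ 2 ≤ q :=
  ⟨h.two_le_time_exponent (Nat.one_le_iff_ne_zero.1 hn) hα hs hp hq,
    h.two_le_space_exponent (Nat.one_le_iff_ne_zero.1 hn) hα hs hp hq⟩
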